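/- Let $S$ be a polycyclic group, i.e. $S$ has a finite series of subgroups $1=H_0\le H_1\le\dots\le H_n=S$ with each $H_i$ normal in $H_{i+1}$ and each quotient $H_{i+1}/H_i$ cyclic. Suppose that $S$ is NIU-linear: for some field $\mathbb F$ (of any characteristic) and some integer $d\ge 1$ there is an injective homomorphism $\rho\colon S\to GL(d,\mathbb F)$ such that every unipotent element of $\rho(S)$ has finite order. (Here $g\in GL(d,\mathbb F)$ is unipotent if some positive power of $g-I$ is zero, equivalently if all eigenvalues of $g$ over $\overline{\mathbb F}$ are equal to $1$.) Then $S$ is virtually abelian, i.e. $S$ has an abelian subgroup of finite index. -/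

import Mathlib

open scoped MatrixGroups

universe u v

/-- A group is polycyclic if it has a finite subnormal series
`1 = H 0 ≤ H 1 ≤ ... ≤ H n = G`, each term normal in the next, with cyclic quotients. -/
def IsPolycyclic (G : Type u) [Group G] : Prop :=
  ∃ (n : ℕ) (H : ℕ → Subgroup G), H 0 = ⊥ ∧ H n = ⊤ ∧
    ∀ i < n, H i ≤ H (i + 1) ∧
      ∃ _ : ((H i).subgroupOf (H (i + 1))).Normal,
        IsCyclic (H (i + 1) ⧸ (H i).subgroupOf (H (i + 1)))

/-- A group is virtually abelian if it has an abelian subgroup of finite index. -/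
def IsVirtuallyAbelian (G : Type u) [Group G] : Prop :=
  ∃ A : Subgroup G, A.FiniteIndex ∧ IsMulCommutative A

/-- An invertible matrix `g` is unipotent if some power of `g - 1` is zero
(equivalently, all its eigenvalues over the algebraic closure are equal to `1`). -/
def IsUnipotentMatrix {F : Type v} [Field F] {d : ℕ} (g : GL (Fin d) F) : Prop :=
  IsNilpotent ((g : Matrix (Fin d) (Fin d) F) - 1)

/-- A subgroup of `GL(d, F)` has no infinite order unipotents if each of its unipotent
elements has finite order. -/
def HasNoInfiniteOrderUnipotents {F : Type v} [Field F] {d : ℕ}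
    (K : Subgroup (GL (Fin d) F)) : Prop :=
  ∀ g ∈ K, IsUnipotentMatrix g → IsOfFinOrder g

/-- An abstract group `G` is NIU-linear if, for some field `F` and some dimension `d ≥ 1`,
it has a faithful representation in `GL(d, F)` whose image has no infinite order unipotents. -/
def IsNIULinear (G : Type u) [Group G] : Prop :=
  ∃ (F : Type v) (_ : Field F) (d : ℕ) (ρ : G →* GL (Fin d) F),
    0 < d ∧ Function.Injective ρ ∧ HasNoInfiniteOrderUnipotents ρ.range

/-! Over an algebraically closed field, a polycyclic linear group has a finite index subgroup `K`
whose commutator subgroup is unipotent, a Lie–Kolchin type statement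
(`exists_finiteIndex_commutator_unipotent`). Its core is that some line has a stabilizer of finite
index (`exists_finiteIndex_lineStabilizer`). The NIU hypothesis then makes `⁅K, K⁆` torsion, hence
finite, being polycyclic. A finitely generated group with finite commutator subgroup has a center of
finite index, and the center of `K` is the required abelian subgroup. -/

/-- `G` has a subnormal series of length `n` with cyclic quotients. -/
def HasCyclicSeries : ℕ → ∀ (G : Type u) [Group G], Prop
  | 0, G, _ => Subsingleton G
  | n + 1, G, _ => ∃ N : Subgroup G, ∃ _ : N.Normal, IsCyclic (G ⧸ N) ∧ HasCyclicSeries n N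

/-! ### Polycyclic groups: subgroups, finite generation, torsion. -/

namespace HasCyclicSeries

theorem of_injective {n : ℕ} {G K : Type u} [Group G] [Group K] (hG : HasCyclicSeries n G)
    (f : K →* G) (hf : Function.Injective f) : HasCyclicSeries n K := by
  induction n generalizing G K with
  | zero =>
    have : Subsingleton G := hG
    exact hf.subsingleton
  | succ n ih =>
    obtain ⟨N, hN, hcyc, hser⟩ := hG
    refine ⟨N.comap f, inferInstance, ?_, ?_⟩
    · refine isCyclic_of_injective (QuotientGroup.map (N.comap f) N f le_rfl) ?_
      rw [injective_iff_map_eq_one]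
      intro a
      induction a using QuotientGroup.induction_on with
      | H z =>
        intro h
        rw [QuotientGroup.map_mk, QuotientGroup.eq_one_iff] at h
        exact (QuotientGroup.eq_one_iff z).2 h
    · refine ih hser (f.subgroupComap N) ?_
      intro a b hab
      exact Subtype.ext (hf (congrArg Subtype.val hab))

theorem subgroup {n : ℕ} {G : Type u} [Group G] (hG : HasCyclicSeries n G) (K : Subgroup G) :
    HasCyclicSeries n K :=
  hG.of_injective K.subtype K.subtype_injective

end HasCyclicSeries

theorem IsPolycyclic.exists_hasCyclicSeries {G : Type u} [Group G] (hG : IsPolycyclic G) :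
    ∃ n, HasCyclicSeries n G := by
  obtain ⟨n, H, h0, hn, hstep⟩ := hG
  have key : ∀ i ≤ n, HasCyclicSeries i (H i) := by
    intro i
    induction i with
    | zero =>
      intro _
      rw [h0]
      exact (inferInstance : Subsingleton (⊥ : Subgroup G))
    | succ i ih =>
      intro hi
      obtain ⟨hle, hnorm, hcyc⟩ := hstep i hi
      exact ⟨_, hnorm, hcyc, (ih (by omega)).of_injective
        (Subgroup.subgroupOfEquivOfLe hle).toMonoidHom
        (Subgroup.subgroupOfEquivOfLe hle).injective⟩
  refine ⟨n, (key n le_rfl).of_injective ((MonoidHom.id G).codRestrict (H n) fun x => ?_) ?_⟩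
  · rw [hn]; trivial
  · intro a b hab
    exact congrArg Subtype.val hab

theorem exists_zpow_mem_of_isCyclic_quotient {G : Type u} [Group G] (N : Subgroup G) [N.Normal]
    [IsCyclic (G ⧸ N)] : ∃ t : G, ∀ g : G, ∃ k : ℤ, ∃ x ∈ N, g = x * t ^ k := by
  obtain ⟨q, hq⟩ := IsCyclic.exists_generator (α := G ⧸ N)
  obtain ⟨t, rfl⟩ := QuotientGroup.mk_surjective q
  refine ⟨t, fun g => ?_⟩
  obtain ⟨k, hk⟩ := Subgroup.mem_zpowers_iff.1 (hq (g : G ⧸ N))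
  refine ⟨k, g * (t ^ k)⁻¹, ?_, by group⟩
  rw [← QuotientGroup.eq_one_iff, QuotientGroup.mk_mul, QuotientGroup.mk_inv,
    QuotientGroup.mk_zpow, hk, mul_inv_cancel]

namespace HasCyclicSeries

theorem fg {n : ℕ} {G : Type u} [Group G] (hG : HasCyclicSeries n G) : Group.FG G := by
  induction n generalizing G with
  | zero =>
    have : Subsingleton G := hG
    infer_instance
  | succ n ih =>
    obtain ⟨N, hN, hcyc, hser⟩ := hG
    obtain ⟨t, ht⟩ := exists_zpow_mem_of_isCyclic_quotient N
    have hNfg : N.FG := (Group.fg_iff_subgroup_fg N).1 (ih hser)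
    have htfg : (Subgroup.zpowers t).FG := ⟨{t}, by simp [Subgroup.zpowers_eq_closure]⟩
    have htop : N ⊔ Subgroup.zpowers t = ⊤ := by
      rw [eq_top_iff]
      intro g _
      obtain ⟨k, x, hx, rfl⟩ := ht g
      exact Subgroup.mul_mem_sup hx (Subgroup.zpow_mem_zpowers t k)
    exact ⟨htop ▸ hNfg.sup htfg⟩

theorem finite_of_isOfFinOrder {n : ℕ} {G : Type u} [Group G] (hG : HasCyclicSeries n G)
    (hfin : ∀ g : G, IsOfFinOrder g) : Finite G := by
  induction n generalizing G with
  | zero =>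
    have : Subsingleton G := hG
    infer_instance
  | succ n ih =>
    obtain ⟨N, hN, hcyc, hser⟩ := hG
    have : Finite N := ih hser fun g => Submonoid.isOfFinOrder_coe.1 (hfin g)
    have : Finite (G ⧸ N) := by
      obtain ⟨q, hq⟩ := IsCyclic.exists_generator (α := G ⧸ N)
      obtain ⟨t, rfl⟩ := QuotientGroup.mk_surjective q
      have h1 : IsOfFinOrder (t : G ⧸ N) := (QuotientGroup.mk' N).isOfFinOrder (hfin t)
      have h2 : (Subgroup.zpowers (t : G ⧸ N) : Set (G ⧸ N)).Finite := finite_zpowers.2 h1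
      exact Set.finite_univ_iff.1 (h2.subset fun x _ => hq x)
    exact Finite.of_subgroup_quotient N

end HasCyclicSeries

/-! ### Characteristic subgroups of finite index. -/

theorem Group.FG.finite_monoidHom {G : Type*} [Group G] (hG : Group.FG G) (P : Type*) [Group P]
    [Finite P] : Finite (G →* P) := by
  obtain ⟨s, hs, hfin⟩ := Group.fg_iff.1 hG
  have : Finite s := hfin
  refine Finite.of_injective (fun (f : G →* P) (x : s) => f x) fun f g hfg => ?_
  exact MonoidHom.eq_of_eqOn_dense hs fun x hx => congrFun hfg ⟨x, hx⟩

/-- A finite index subgroup of a finitely generated group contains a characteristic one. -/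
theorem Group.FG.exists_characteristic_le {G : Type*} [Group G] (hG : Group.FG G)
    (K : Subgroup G) [K.FiniteIndex] :
    ∃ C : Subgroup G, C.Characteristic ∧ C.FiniteIndex ∧ C ≤ K := by
  have : Finite (G ⧸ K) := inferInstance
  have : Finite (G →* Equiv.Perm (G ⧸ K)) := hG.finite_monoidHom _
  -- Precomposition with an automorphism keeps the family of these kernels stable, and the family is
  -- finite.
  refine ⟨⨅ f : G →* Equiv.Perm (G ⧸ K), f.ker, ?_, ?_, ?_⟩
  · rw [Subgroup.characteristic_iff_le_comap]
    intro φ g hg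
    simp only [Subgroup.mem_comap, Subgroup.mem_iInf, MonoidHom.mem_ker] at hg ⊢
    exact fun f => hg (f.comp φ.toMonoidHom)
  · exact Subgroup.finiteIndex_iInf fun f => Subgroup.finiteIndex_ker f
  · refine (iInf_le _ (MulAction.toPermHom G (G ⧸ K))).trans ?_
    rw [← Subgroup.normalCore_eq_ker]
    exact K.normalCore_le

/-- In finite dimension this leaves only finitely many weights. -/
theorem linearIndependent_of_common_eigenvectors {F V ι C : Type*} [Field F] [AddCommGroup V]
    [Module F V] (f : C → V →ₗ[F] V) (w : ι → V) (χ : ι → C → F) (hw : ∀ i, w i ≠ 0)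
    (hχ : Function.Injective χ) (h : ∀ i c, f c (w i) = χ i c • w i) : LinearIndependent F w := by
  classical
  rw [linearIndependent_iff']
  intro s
  induction s using Finset.induction_on with
  | empty => simp
  | insert j s hj ih =>
    intro a ha
    have hs : ∀ i ∈ s, a i = 0 := by
      intro i hi
      obtain ⟨c, hc⟩ : ∃ c, χ i c ≠ χ j c :=
        Function.ne_iff.1 (hχ.ne (ne_of_mem_of_not_mem hi hj))
      have h1 : ∑ i ∈ insert j s, (a i * (χ i c - χ j c)) • w i = 0 := by
        have := congrArg (fun x => f c x - χ j c • x) ha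
        simp only [map_sum, map_smul, h, map_zero, smul_zero, sub_zero, Finset.smul_sum,
          ← Finset.sum_sub_distrib] at this
        rw [← this]
        refine Finset.sum_congr rfl fun i _ => ?_
        module
      rw [Finset.sum_insert hj, sub_self, mul_zero, zero_smul, zero_add] at h1
      exact (mul_eq_zero.1 (ih _ h1 i hi)).resolve_right (sub_ne_zero.2 hc)
    intro i hi
    rcases Finset.mem_insert.1 hi with rfl | hi
    · rw [Finset.sum_insert hj, Finset.sum_eq_zero fun k hk => by rw [hs k hk, zero_smul],
        add_zero] at ha
      exact (smul_eq_zero.1 ha).resolve_right (hw _)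
    · exact hs i hi

/-- If `G = N⟨t⟩`, a subgroup containing a positive power of `t` and a `G`-normal finite index
subgroup of `N` has finite index in `G`. -/
theorem Subgroup.finiteIndex_of_pow_mem {G : Type*} [Group G] {N K : Subgroup G} {t : G}
    (ht : ∀ g : G, ∃ k : ℤ, ∃ x ∈ N, g = x * t ^ k) (C : Subgroup N) [C.FiniteIndex]
    [(C.map N.subtype).Normal] (hC : C.map N.subtype ≤ K) {m : ℕ} (hm : 0 < m)
    (htK : t ^ m ∈ K) : K.FiniteIndex := by
  have : Finite (N ⧸ C) := inferInstance
  have : Finite (G ⧸ K) := by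
    refine Finite.of_surjective
      (fun p : (N ⧸ C) × Fin m => (((p.1.out : N) * t ^ (p.2 : ℕ) : G) : G ⧸ K)) fun q => ?_
    obtain ⟨g, rfl⟩ := QuotientGroup.mk_surjective q
    obtain ⟨k, x, hx, rfl⟩ := ht g
    have hm' : (0 : ℤ) < m := by exact_mod_cast hm
    have hr0 := Int.emod_nonneg k hm'.ne'
    have hr1 := Int.emod_lt_of_pos k hm'
    obtain ⟨r, hr⟩ := Int.eq_ofNat_of_zero_le hr0
    refine ⟨(((⟨x, hx⟩ : N) : N ⧸ C), ⟨r, by omega⟩), ?_⟩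
    obtain ⟨c, hc⟩ := QuotientGroup.mk_out_eq_mul C (⟨x, hx⟩ : N)
    simp only [hc]
    rw [QuotientGroup.eq]
    have hcN : ((c : N) : G) ∈ C.map N.subtype := Subgroup.mem_map_of_mem _ c.2
    have h1 := Subgroup.Normal.conj_mem inferInstance _ (inv_mem hcN) (t ^ r)⁻¹
    have hk : t ^ k = t ^ r * (t ^ m) ^ (k / m) := by
      rw [← zpow_natCast, ← zpow_natCast, ← zpow_mul, ← zpow_add, ← hr,
        Int.emod_add_mul_ediv]
    have h2 := K.mul_mem (hC h1) (K.zpow_mem htK (k / m))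
    convert h2 using 1
    rw [hk]
    push_cast
    group
  exact Subgroup.finiteIndex_of_finite_quotient

/-! ### Lines with stabilizer of finite index. -/

/-- The stabilizer of the line spanned by a nonzero vector. -/
def Representation.lineStabilizer {F V G : Type*} [Field F] [AddCommGroup V] [Module F V] [Group G]
    (ρ : Representation F G V) (w : V) (hw : w ≠ 0) : Subgroup G where
  carrier := {g | ∃ c : F, ρ g w = c • w}
  one_mem' := ⟨1, by simp⟩
  mul_mem' := by
    rintro a b ⟨c, hc⟩ ⟨d, hd⟩
    exact ⟨d * c, by rw [map_mul, Module.End.mul_apply, hd, map_smul, hc, smul_smul]⟩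
  inv_mem' := by
    rintro a ⟨c, hc⟩
    have h1 : w = c • ρ a⁻¹ w := by
      rw [← map_smul, ← hc, Representation.inv_self_apply]
    have hc0 : c ≠ 0 := by
      rintro rfl
      exact hw (by rw [h1, zero_smul])
    exact ⟨c⁻¹, by rw [eq_inv_smul_iff₀ hc0, ← h1]⟩

/-- Conjugation by `t` moves the weights of a normal subgroup `D`. As there are finitely many
weights, some `t ^ m` fixes one of them, so it preserves that weight space and has an eigenvector
there. -/
theorem HasCyclicSeries.exists_finiteIndex_lineStabilizer {F : Type*} [Field F] [IsAlgClosed F]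
    {V : Type*} [AddCommGroup V] [Module F V] [FiniteDimensional F V] [Nontrivial V]
    {n : ℕ} {G : Type u} [Group G] (hG : HasCyclicSeries n G) (ρ : Representation F G V) :
    ∃ (w : V) (hw : w ≠ 0), (ρ.lineStabilizer w hw).FiniteIndex := by
  induction n generalizing G with
  | zero =>
    have : Subsingleton G := hG
    obtain ⟨w, hw⟩ := exists_ne (0 : V)
    exact ⟨w, hw, inferInstance⟩
  | succ n ih =>
    obtain ⟨N, hN, hcyc, hser⟩ := hG
    obtain ⟨t, ht⟩ := exists_zpow_mem_of_isCyclic_quotient N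
    obtain ⟨w, hw, hfi⟩ := ih hser (ρ.comp N.subtype)
    -- Characteristic in `N` gives normal in `G`, so `t` acts on the weights of `C`.
    obtain ⟨C, hchar, hCfi, hC⟩ := hser.fg.exists_characteristic_le
      (Representation.lineStabilizer (ρ.comp N.subtype) w hw)
    have hnorm : (C.map N.subtype).Normal := inferInstance
    set D : Subgroup G := C.map N.subtype
    have hDw : ∀ c : D, ∃ a : F, ρ c w = a • w := by
      rintro ⟨_, c, hc, rfl⟩
      exact hC hc
    choose χ hχ using hDw
    -- the weights of `D` on the translates `t ^ i • w`
    let ψ : ℕ → D → F := fun i c =>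
      χ ⟨(t ^ i)⁻¹ * c * t ^ i, by simpa using hnorm.conj_mem c c.2 (t ^ i)⁻¹⟩
    have hψ : ∀ i (c : D), ρ c (ρ (t ^ i) w) = ψ i c • ρ (t ^ i) w := by
      intro i c
      rw [← map_smul, ← hχ, ← Module.End.mul_apply, ← Module.End.mul_apply, ← map_mul, ← map_mul]
      congr 2
      group
    have hne : ∀ i, ρ (t ^ i) w ≠ 0 := fun i h =>
      hw ((ρ.apply_bijective (t ^ i)).injective (by rw [h, map_zero]))
    have hninj : ¬ Function.Injective ψ := fun hinj =>
      Module.Finite.not_linearIndependent_of_infinite (R := F) (fun i => ρ (t ^ i) w)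
        (linearIndependent_of_common_eigenvectors (fun c : D => ρ c) _ ψ hne hinj hψ)
    obtain ⟨i, m, hm, him⟩ : ∃ i m, 0 < m ∧ ψ i = ψ (i + m) := by
      simp only [Function.Injective, not_forall] at hninj
      obtain ⟨i, j, hij, hne⟩ := hninj
      rcases lt_or_gt_of_ne hne with h | h
      · exact ⟨i, j - i, by omega, by rw [hij]; congr 1; omega⟩
      · exact ⟨j, i - j, by omega, by rw [← hij]; congr 1; omega⟩
    have hinv : ∀ c : D, ψ i ⟨(t ^ m)⁻¹ * c * t ^ m,
        by simpa using hnorm.conj_mem c c.2 (t ^ m)⁻¹⟩ = ψ i c := by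
      intro c
      conv_rhs => rw [him]
      simp only [ψ]
      congr 2
      rw [add_comm i m, pow_add]
      group
    -- the weight space is invariant under `t ^ m`
    let W : Submodule F V := ⨅ c : D, Module.End.eigenspace (ρ c) (ψ i c)
    have hWmem : ∀ x, x ∈ W ↔ ∀ c : D, ρ c x = ψ i c • x := by
      intro x
      simp [W, Submodule.mem_iInf]
    have hWt : ∀ x ∈ W, ρ (t ^ m) x ∈ W := by
      intro x hx
      rw [hWmem] at hx ⊢
      intro c
      rw [← hinv c, ← map_smul, ← hx, ← Module.End.mul_apply, ← Module.End.mul_apply, ← map_mul,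
        ← map_mul]
      congr 2
      group
    have : Nontrivial W := by
      rw [Submodule.nontrivial_iff_ne_bot, Submodule.ne_bot_iff]
      exact ⟨ρ (t ^ i) w, (hWmem _).2 (hψ i), hne i⟩
    obtain ⟨μ, hμ⟩ := Module.End.exists_eigenvalue ((ρ (t ^ m)).restrict hWt)
    obtain ⟨z, hz⟩ := hμ.exists_hasEigenvector
    have hz0 : (z : V) ≠ 0 := fun h => hz.2 (Subtype.ext h)
    refine ⟨z, hz0, Subgroup.finiteIndex_of_pow_mem ht C (fun c hc => ?_) hm ?_⟩
    · exact ⟨_, (hWmem _).1 z.2 ⟨c, hc⟩⟩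
    · exact ⟨μ, congrArg Subtype.val hz.apply_eq_smul⟩

theorem Representation.apply_eq_of_mem_commutator_lineStabilizer {F V G : Type*} [Field F]
    [AddCommGroup V] [Module F V] [Group G] (ρ : Representation F G V) {w : V} (hw : w ≠ 0) {g : G}
    (hg : g ∈ ⁅ρ.lineStabilizer w hw, ρ.lineStabilizer w hw⁆) : ρ g w = w := by
  let S : Subgroup G :=
    { carrier := {g | ρ g w = w}
      one_mem' := by simp
      mul_mem' := by
        intro a b ha hb
        simp only [Set.mem_ofPred_eq, map_mul, Module.End.mul_apply] at *
        rw [hb, ha]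
      inv_mem' := by
        intro a ha
        simp only [Set.mem_ofPred_eq] at *
        conv_lhs => rw [← ha]
        rw [Representation.inv_self_apply] }
  have hle : ⁅ρ.lineStabilizer w hw, ρ.lineStabilizer w hw⁆ ≤ S := by
    rw [Subgroup.commutator_le]
    rintro a ha b hb
    obtain ⟨d, hd⟩ := inv_mem ha
    obtain ⟨e, he⟩ := inv_mem hb
    change ρ (a * b * a⁻¹ * b⁻¹) w = w
    have hcomm : ρ (a⁻¹ * b⁻¹) w = ρ (b⁻¹ * a⁻¹) w := by
      simp only [map_mul, Module.End.mul_apply, hd, he, map_smul]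
      exact smul_comm _ _ _
    rw [mul_assoc, map_mul, Module.End.mul_apply, hcomm,
      ← Module.End.mul_apply, ← map_mul]
    simp
  exact hle hg

/-- Induction on dimension through `V ⧸ L`, with `L` a line stabilized up to finite index.
Commutators act trivially on `L` because scalars commute, so one more factor `ρ g - 1` kills what
the quotient leaves in `L`. -/
theorem HasCyclicSeries.exists_finiteIndex_commutator_unipotent {F : Type*} [Field F]
    [IsAlgClosed F] {d : ℕ} {V : Type*} [AddCommGroup V] [Module F V] [FiniteDimensional F V]
    (hd : Module.finrank F V = d) {n : ℕ} {G : Type u} [Group G] (hG : HasCyclicSeries n G)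
    (ρ : Representation F G V) :
    ∃ K : Subgroup G, K.FiniteIndex ∧ ∀ g ∈ ⁅K, K⁆, IsNilpotent (ρ g - 1) := by
  induction d generalizing V G with
  | zero =>
    have : Subsingleton V := Module.finrank_zero_iff.1 hd
    exact ⟨⊤, inferInstance, fun g _ => ⟨1, LinearMap.ext fun x => Subsingleton.elim _ _⟩⟩
  | succ d ih =>
    have : Nontrivial V := Module.nontrivial_of_finrank_pos (R := F) (by omega)
    obtain ⟨w, hw, hfi⟩ := hG.exists_finiteIndex_lineStabilizer ρ
    set K₁ := ρ.lineStabilizer w hw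
    let L : Submodule F V := Submodule.span F {w}
    have hL : ∀ g : K₁, L ≤ L.comap (ρ g) := by
      intro g
      rw [Submodule.span_singleton_le_iff_mem, Submodule.mem_comap, Submodule.mem_span_singleton]
      obtain ⟨c, hc⟩ := g.2
      exact ⟨c, hc.symm⟩
    have hdim : Module.finrank F (V ⧸ L) = d := by
      have h1 := L.finrank_quotient_add_finrank
      rw [finrank_span_singleton hw] at h1
      omega
    obtain ⟨K₂, hK₂, hnil⟩ := ih hdim (hG.subgroup K₁)
      (Representation.quotient (ρ.comp K₁.subtype) L hL)
    refine ⟨K₂.map K₁.subtype, ?_, ?_⟩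
    · rw [Subgroup.finiteIndex_iff, Subgroup.index_map_subtype]
      exact mul_ne_zero hK₂.index_ne_zero hfi.index_ne_zero
    · rw [← Subgroup.map_commutator]
      rintro _ ⟨g, hg, rfl⟩
      obtain ⟨k, hk⟩ := hnil g hg
      have hgw : ρ (g : G) w = w := by
        refine ρ.apply_eq_of_mem_commutator_lineStabilizer hw ?_
        have h1 : (g : G) ∈ (⁅K₂, K₂⁆).map K₁.subtype := Subgroup.mem_map_of_mem _ hg
        rw [Subgroup.map_commutator] at h1
        exact Subgroup.commutator_mono (Subgroup.map_subtype_le _) (Subgroup.map_subtype_le _) h1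
      have hpow : ∀ (j : ℕ) (x : V), ((Representation.quotient (ρ.comp K₁.subtype) L hL g - 1) ^ j) (L.mkQ x) =
          L.mkQ (((ρ (g : G) - 1) ^ j) x) := by
        intro j
        induction j with
        | zero => simp
        | succ j ihj =>
          intro x
          rw [pow_succ, pow_succ, Module.End.mul_apply, Module.End.mul_apply, ← ihj]
          rfl
      refine ⟨k + 1, LinearMap.ext fun x => ?_⟩
      have hx : ((ρ (g : G) - 1) ^ k) x ∈ L := by
        rw [← Submodule.ker_mkQ L, LinearMap.mem_ker, ← hpow, hk, LinearMap.zero_apply]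
      obtain ⟨c, hc⟩ := Submodule.mem_span_singleton.1 hx
      change ((ρ (g : G) - 1) ^ (k + 1)) x = 0
      rw [pow_succ', Module.End.mul_apply, ← hc, map_smul, LinearMap.sub_apply, hgw,
        Module.End.one_apply, sub_self, smul_zero]

theorem mainTheorem6 (S : Type u) [Group S] (hpoly : IsPolycyclic S)
    (hNIU : IsNIULinear.{u, v} S) : IsVirtuallyAbelian S := by
  obtain ⟨n, hS⟩ := hpoly.exists_hasCyclicSeries
  obtain ⟨F, _, d, ρ, -, hinj, hniu⟩ := hNIU
  let E := AlgebraicClosure F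
  let f : Matrix (Fin d) (Fin d) F →+* ((Fin d → E) →ₗ[E] (Fin d → E)) :=
    (Matrix.toLinAlgEquiv' (R := E) (n := Fin d)).toAlgHom.toRingHom.comp
      (algebraMap F E).mapMatrix
  have hf : Function.Injective f :=
    (Matrix.toLinAlgEquiv' (R := E) (n := Fin d)).injective.comp
      (Matrix.map_injective (algebraMap F E).injective)
  let σ : Representation E S (Fin d → E) := f.toMonoidHom.comp ((Units.coeHom _).comp ρ)
  obtain ⟨K, hK, hunip⟩ := hS.exists_finiteIndex_commutator_unipotent rfl σ
  have hfin : ∀ g ∈ ⁅K, K⁆, IsOfFinOrder g := by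
    intro g hg
    refine hinj.isOfFinOrder_iff.1 (hniu (ρ g) ⟨g, rfl⟩ ?_)
    refine (IsNilpotent.map_iff hf).1 ?_
    rw [map_sub, map_one]
    exact hunip g hg
  have : Group.FG K := (hS.subgroup K).fg
  have : Finite (commutator K) := by
    refine ((hS.subgroup K).subgroup _).finite_of_isOfFinOrder fun g => ?_
    rw [← Submonoid.isOfFinOrder_coe, ← Submonoid.isOfFinOrder_coe]
    refine hfin _ ?_
    have h1 : ((g : K) : S) ∈ (commutator K).map K.subtype := Subgroup.mem_map_of_mem _ g.2
    rwa [Subgroup.map_subtype_commutator] at h1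
  have : Finite (commutatorSet K) :=
    Set.Finite.subset (Set.toFinite (commutator K : Set K)) (by
      rw [commutator_eq_closure]; exact Subgroup.subset_closure)
  refine ⟨(Subgroup.center K).map K.subtype, ?_, inferInstance⟩
  rw [Subgroup.finiteIndex_iff, Subgroup.index_map_subtype]
  -- The center of `K` is the intersection of the centralizers of finitely many generators, each
  -- with finitely many conjugates.
  exact mul_ne_zero Subgroup.FiniteIndex.index_ne_zero hK.index_ne_zero
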